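/- Let $(V,E)$ be a finite connected simple graph with edge set $E=\{e_1,\dots,e_m\}$. For a positive weight ${\bf w}=(w_e)_{e\in E}\in\mathbb{R}^m_+=\{{\bf w}\in\mathbb{R}^m: w_e>0 \text{ for all } e\in E\}$ let $$d(u,v)=\min_{\gamma}\sum_{e\in\gamma}w_e ,$$ where $\gamma$ runs over all paths connecting $u$ and $v$. For $\alpha\in[0,1]$ and a vertex $u$ let $\mu_u^\alpha$ be given by $\mu_u^\alpha(u)=\alpha$, $\mu_u^\alpha(z)=(1-\alpha)\,w_{zu}/\sum_{y\sim u}w_{yu}$ if $z\sim u$, and $\mu_u^\alpha(z)=0$ otherwise. For $\mu,\nu:V\to[0,\infty)$ with total mass $1$ let $W(\mu,\nu)=\inf_\pi\sum_{a,b\in V}d(a,b)\,\pi(a,b)$ be the transportation distance, the infimum being over all $\pi:V\times V\to[0,\infty)$ with marginals $\mu$ and $\nu$. For an edge $e=xy$ put $\rho_e=d(x,y)$ and let $$\kappa_e=\lim_{\alpha\to1^-}\frac{1}{1-\alpha}\left[1-\frac{W(\mu_x^\alpha,\mu_y^\alpha)}{d(x,y)}\right]$$ be the Lin–Lu–Yau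 Ricci curvature of $e$; this limit exists for every ${\bf w}\in\mathbb{R}^m_+$. When the weight is ${\bf w}(t)$, write $\rho_e(t)$ and $\kappa_e(t)$ for the corresponding quantities. Then for every initial weight ${\bf w}_0=(w_{0,e})_{e\in E}\in\mathbb{R}^m_+$ the modified Ricci flow $$\frac{d}{dt}w_{e}(t)=-\kappa_{e}(t)\,\rho_{e}(t),\qquad w_{e}(0)=w_{0,e},\qquad e\in E,$$ has a unique solution ${\bf w}(t)\in\mathbb{R}^m_+$ defined for all $t\in[0,+\infty)$ (with the one-sided derivative at $t=0$). Moreover, every solution with values in $\mathbb{R}^m_+$ and the same initial weight on an interval $[0,T)$, $T>0$, is the restriction of this one. The edge set is the same at all times: no exit condition is imposed and no edge is removed. -/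

import Mathlib

open Filter Topology

/-!
Edge weights, path distance, transportation distance, Lin-Lu-Yau curvature and the modified Ricci
flow on a finite simple graph `G`.  An edge weight is a function `w : G.edgeSet → ℝ`; the graph and
its edge set never change with time.
-/
namespace RicciFlow

noncomputable section

variable {V : Type*} {G : SimpleGraph V}

open Classical in
/-- The weight of an unordered pair of vertices: the weight of the edge, `0` for a non-edge. -/
def weight (w : G.edgeSet → ℝ) (e : Sym2 V) : ℝ :=
  if h : e ∈ G.edgeSet then w ⟨e, h⟩ else 0

/-- The length of a walk: the sum of the weights of its edges. -/
def length (w : G.edgeSet → ℝ) {x y : V} (p : G.Walk x y) : ℝ :=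
  (p.edges.map (weight w)).sum

/-- The path distance `d(x, y)`: the least length of a path from `x` to `y`.  On a finite connected
graph the infimum is over a finite nonempty family, so it is a minimum. -/
def dist (w : G.edgeSet → ℝ) (x y : V) : ℝ :=
  ⨅ p : G.Path x y, length w p.1

variable [Fintype V]

open Classical in
/-- The lazy random walk measure `μ_u^α`: mass `α` at `u`, and mass `1 - α` shared among the
neighbours of `u` in proportion to the weights of the edges that join them to `u`. -/
def walkMeasure (w : G.edgeSet → ℝ) (α : ℝ) (u z : V) : ℝ :=
  if z = u then α
  else if G.Adj z u then
    (1 - α) * (weight w s(z, u) / ∑ y ∈ Finset.univ.filter (fun y => G.Adj y u), weight w s(y, u))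
  else 0

/-- `π` is a coupling (transport plan) of the finite measures `μ` and `ν`. -/
structure IsCoupling (μ ν : V → ℝ) (π : V → V → ℝ) : Prop where
  nonneg : ∀ a b, 0 ≤ π a b
  fst_marginal : ∀ a, ∑ b, π a b = μ a
  snd_marginal : ∀ b, ∑ a, π a b = ν b

/-- The transportation distance for the cost `d`: the least cost of a coupling. -/
def transportDist (d : V → V → ℝ) (μ ν : V → ℝ) : ℝ :=
  sInf {c : ℝ | ∃ π : V → V → ℝ, IsCoupling μ ν π ∧ c = ∑ a, ∑ b, d a b * π a b}

/-- The `α`-Ricci curvature divided by `1 - α`. -/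
def curvatureQuotient (w : G.edgeSet → ℝ) (x y : V) (α : ℝ) : ℝ :=
  1 / (1 - α) *
    (1 - transportDist (dist w) (walkMeasure w α x) (walkMeasure w α y) / dist w x y)

/-- The Lin-Lu-Yau Ricci curvature `κ(x, y)`, the limit as `α → 1` from below. -/
def curvature (w : G.edgeSet → ℝ) (x y : V) : ℝ :=
  limUnder (𝓝[<] (1 : ℝ)) (curvatureQuotient w x y)

/-- `w` solves the modified Ricci flow `w_e' = - κ_e ρ_e` with initial weight `w₀` on the set `I` of
times: all the weights stay positive, and the equation holds at each time in `I` for each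
edge `e = xy` (derivatives are taken within `I`, so they are one-sided at time `0`). -/
structure IsSolution (w₀ : G.edgeSet → ℝ) (I : Set ℝ) (w : ℝ → G.edgeSet → ℝ) : Prop where
  initial : w 0 = w₀
  pos : ∀ t ∈ I, ∀ e, 0 < w t e
  deriv : ∀ t ∈ I, ∀ (x y : V) (h : G.Adj x y),
    HasDerivWithinAt (fun r => w r ⟨s(x, y), G.mem_edgeSet.mpr h⟩)
      (-(curvature (w t) x y * dist (w t) x y)) I t

end

end RicciFlow

/-! The Lipschitz dual description of the transportation distance turns the flow into an ODE with
explicit bounds. Integrating `f` against `μ_x^α` gives `f x + (1 - α) * Δf(x)`, with `Δ` the random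
walk Laplacian. By Kantorovich duality `W` is therefore the supremum, over `1`-Lipschitz `f`, of `f
x - f y + (1 - α) * (Δf(x) - Δf(y))`. A function that misses `f x - f y = d x y` by `η` can be moved
by at most `η` to one that attains it. This changes the Laplacian difference by at most `4 * η`, so
for `1 - α ≤ 1/4` only exact potentials matter and `W` is affine in `α`
(`transportDist_walkMeasure`). Hence the curvature limit exists and `-κ ρ` equals `flowRate`, the
supremum of `Δf(x) - Δf(y)` over potentials.

The same correction, applied between two nearby metrics, makes `flowRate` Lipschitz on boxes of
positive weights (`flowRate_le_add`), even though the potentials vary with the metric. Moreover `-2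
* w_e ≤ flowRate ≤ 2 * ∑ w`: weights decay at most exponentially, and their sum grows at most
exponentially. No weight vanishes or blows up in finite time, so Picard–Lindelöf for a truncated
field gives global solutions (`exists_isPositiveCurve_Ici`), and uniqueness is local
(`IsPositiveCurve.eqOn`). -/

namespace RicciFlow

/-! ### Lipschitz functions and potentials of a pseudometric. -/

section Lipschitz

variable {V : Type*}

/-- `f` is `1`-Lipschitz for the cost `d`. -/
def IsLip (d : V → V → ℝ) (f : V → ℝ) : Prop := ∀ a b, f a - f b ≤ d a b

/-- A cost function that is a pseudometric. -/
structure IsPseudoMetric (d : V → V → ℝ) : Prop where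
  self : ∀ a, d a a = 0
  symm : ∀ a b, d a b = d b a
  triangle : ∀ a b c, d a c ≤ d a b + d b c

lemma IsPseudoMetric.nonneg {d : V → V → ℝ} (hd : IsPseudoMetric d) (a b : V) : 0 ≤ d a b := by
  linarith [hd.triangle a b a, hd.symm a b, hd.self a]

/-- The inf-convolution of `h` with the cost `d`. -/
noncomputable def infConv (d : V → V → ℝ) (h : V → ℝ) (z : V) : ℝ := ⨅ v, (d z v + h v)

lemma infConv_le [Finite V] (d : V → V → ℝ) (h : V → ℝ) (z v : V) : infConv d h z ≤ d z v + h v :=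
  ciInf_le (Set.finite_range fun v => d z v + h v).bddBelow v

lemma isLip_infConv [Finite V] {d : V → V → ℝ} (hd : IsPseudoMetric d) (h : V → ℝ) :
    IsLip d (infConv d h) := by
  intro a b
  have : Nonempty V := ⟨a⟩
  rw [sub_le_comm]
  refine le_ciInf fun v => ?_
  linarith [infConv_le d h a v, hd.triangle a b v]

/-- The `1`-Lipschitz functions that realise the distance from `x` to `y`. -/
def potentials (d : V → V → ℝ) (x y : V) : Set (V → ℝ) := {f | IsLip d f ∧ f x - f y = d x y}

lemma IsLip.min {d : V → V → ℝ} {f g : V → ℝ} (hf : IsLip d f) (hg : IsLip d g) :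
    IsLip d fun z => min (f z) (g z) := by
  intro a b
  rw [sub_le_comm]
  exact le_min (by linarith [min_le_left (f a) (g a), hf a b])
    (by linarith [min_le_right (f a) (g a), hg a b])

lemma IsLip.max {d : V → V → ℝ} {f g : V → ℝ} (hf : IsLip d f) (hg : IsLip d g) :
    IsLip d fun z => max (f z) (g z) := by
  intro a b
  rw [sub_le_iff_le_add]
  exact max_le (by linarith [le_max_left (f b) (g b), hf a b])
    (by linarith [le_max_right (f b) (g b), hg a b])

/-- A function that is `1`-Lipschitz for `d` and nearly realises `d x y` is close to a potential of
any nearby pseudometric. -/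
lemma exists_potential_near [Finite V] {d d' : V → V → ℝ} (hd' : IsPseudoMetric d') {ε η : ℝ}
    (hε : 0 ≤ ε) (hη : 0 ≤ η) (hdd : ∀ a b, |d a b - d' a b| ≤ ε) {f : V → ℝ} (hf : IsLip d f)
    {x y : V} (hxy : d x y - η ≤ f x - f y) :
    ∃ f' ∈ potentials d' x y, ∀ z, |f' z - f z| ≤ 2 * ε + η := by
  have hV : Nonempty V := ⟨x⟩
  have hr : ∀ c v, IsLip d' fun z => c + d' v z := fun c v a b => by
    linarith [hd'.triangle v b a, hd'.symm a b]
  have hl : ∀ c v, IsLip d' fun z => c - d' v z := fun c v a b => by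
    linarith [hd'.triangle v a b]
  -- The inf-convolution is the `d'`-Lipschitz approximation of `f`. The maximum with the downward
  -- cone at `x` lifts the value at `x` to at least `f y + d' x y`. The minimum with the upward cone
  -- at `y` then pins the values at `x` and `y` exactly.
  refine ⟨fun z => min (f y + d' y z) (max (f y + d' x y - d' x z) (infConv d' f z)),
    ⟨(hr _ _).min ((hl _ _).max (isLip_infConv hd' f)), ?_⟩, fun z => ?_⟩
  · have e1 : min (f y + d' y x) (max (f y + d' x y - d' x x) (infConv d' f x)) = f y + d' x y := by
      rw [hd'.self, hd'.symm y x, sub_zero]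
      exact min_eq_left (le_max_left _ _)
    have e2 : min (f y + d' y y) (max (f y + d' x y - d' x y) (infConv d' f y)) = f y := by
      rw [hd'.self, add_zero]
      exact min_eq_left (le_trans (by linarith) (le_max_left _ _))
    simp only [e1, e2]
    ring
  · have h1 : infConv d' f z ≤ f z := by linarith [infConv_le d' f z z, hd'.self z]
    have h2 : f z - ε ≤ infConv d' f z :=
      le_ciInf fun v => by linarith [hf z v, (abs_le.mp (hdd z v)).2]
    have h3 : f z - ε ≤ f y + d' y z := by
      linarith [hf z y, (abs_le.mp (hdd z y)).2, hd'.symm z y]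
    have h4 : f y + d' x y - d' x z ≤ f z + (2 * ε + η) := by
      linarith [hf x z, (abs_le.mp (hdd x z)).2, (abs_le.mp (hdd x y)).1]
    rw [abs_le]
    constructor
    · have : f z - ε ≤ min (f y + d' y z) (max (f y + d' x y - d' x z) (infConv d' f z)) :=
        le_min h3 (h2.trans (le_max_right _ _))
      linarith
    · have : min (f y + d' y z) (max (f y + d' x y - d' x z) (infConv d' f z)) ≤
          f z + (2 * ε + η) := (min_le_right _ _).trans (max_le h4 (by linarith))
      linarith

end Lipschitz

/-! ### Kantorovich duality on a finite set. -/

section Transport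

variable {V : Type*} [Fintype V]

/-- The values of the dual transport problem with cost bounded below by `u`. -/
def dualValues (μ ν : V → ℝ) (u : V × V → ℝ) : Set ℝ :=
  {c | ∃ φ ψ : V → ℝ, (∀ a b, u (a, b) ≤ φ a + ψ b) ∧ c = ∑ a, φ a * μ a + ∑ b, ψ b * ν b}

lemma dualValues_nonempty (μ ν : V → ℝ) (u : V × V → ℝ) : (dualValues μ ν u).Nonempty := by
  obtain ⟨M, hM⟩ := (Set.finite_range u).bddAbove
  refine ⟨_, fun _ => M, fun _ => 0, fun a b => ?_, rfl⟩
  simpa using hM ⟨(a, b), rfl⟩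

/-- Integrate the constraint against the product coupling. This keeps the dual infimum finite. -/
lemma le_of_mem_dualValues {μ ν : V → ℝ} (hμ : ∀ a, 0 ≤ μ a) (hν : ∀ a, 0 ≤ ν a)
    (hμ1 : ∑ a, μ a = 1) (hν1 : ∑ a, ν a = 1) {u : V × V → ℝ} {c : ℝ}
    (hc : c ∈ dualValues μ ν u) : ∑ a, ∑ b, u (a, b) * (μ a * ν b) ≤ c := by
  obtain ⟨φ, ψ, h, rfl⟩ := hc
  have h1 : ∑ a, φ a * μ a = ∑ a, ∑ b, φ a * (μ a * ν b) := by
    refine Finset.sum_congr rfl fun a _ => ?_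
    rw [← Finset.mul_sum, ← Finset.mul_sum, hν1, mul_one]
  have h2 : ∑ b, ψ b * ν b = ∑ a, ∑ b, ψ b * (μ a * ν b) := by
    rw [Finset.sum_comm]
    refine Finset.sum_congr rfl fun a _ => ?_
    rw [← Finset.mul_sum, ← Finset.sum_mul, hμ1, one_mul]
  rw [h1, h2, ← Finset.sum_add_distrib]
  refine Finset.sum_le_sum fun a _ => ?_
  rw [← Finset.sum_add_distrib]
  refine Finset.sum_le_sum fun b _ => ?_
  rw [← add_mul]
  exact mul_le_mul_of_nonneg_right (h a b) (mul_nonneg (hμ a) (hν b))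

lemma bddBelow_dualValues {μ ν : V → ℝ} (hμ : ∀ a, 0 ≤ μ a) (hν : ∀ a, 0 ≤ ν a)
    (hμ1 : ∑ a, μ a = 1) (hν1 : ∑ a, ν a = 1) (u : V × V → ℝ) : BddBelow (dualValues μ ν u) :=
  ⟨_, fun _ hc => le_of_mem_dualValues hμ hν hμ1 hν1 hc⟩

/-- **Kantorovich duality** with attainment on the primal side. -/
theorem exists_coupling_cost_eq_sInf {μ ν : V → ℝ} (hμ : ∀ a, 0 ≤ μ a) (hν : ∀ a, 0 ≤ ν a)
    (hμ1 : ∑ a, μ a = 1) (hν1 : ∑ a, ν a = 1) (u : V × V → ℝ) :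
    ∃ π : V → V → ℝ, IsCoupling μ ν π ∧ ∑ a, ∑ b, u (a, b) * π a b = sInf (dualValues μ ν u) := by
  classical
  -- The dual value is a sublinear functional of the cost. Hahn–Banach extends `c • u ↦ c * N u` to
  -- a linear functional below `N`, and this functional is integration against the optimal coupling.
  set N : (V × V → ℝ) → ℝ := fun u => sInf (dualValues μ ν u) with hN
  have hbdd := bddBelow_dualValues hμ hν hμ1 hν1
  have hne := dualValues_nonempty μ ν
  have hle : ∀ (v : V × V → ℝ) (φ ψ : V → ℝ), (∀ a b, v (a, b) ≤ φ a + ψ b) →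
      N v ≤ ∑ a, φ a * μ a + ∑ b, ψ b * ν b := fun v φ ψ h =>
    csInf_le (hbdd v) ⟨φ, ψ, h, rfl⟩
  have hom_le : ∀ c : ℝ, 0 < c → ∀ v, N (c • v) ≤ c * N v := by
    intro c hc v
    rw [← div_le_iff₀' hc]
    refine le_csInf (hne v) ?_
    rintro _ ⟨φ, ψ, h, rfl⟩
    rw [div_le_iff₀' hc]
    refine (hle (c • v) (c • φ) (c • ψ) fun a b => ?_).trans_eq ?_
    · simpa [← mul_add] using mul_le_mul_of_nonneg_left (h a b) hc.le
    · simp [mul_add, Finset.mul_sum, mul_assoc]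
  have N_hom : ∀ c : ℝ, 0 < c → ∀ v, N (c • v) = c * N v := by
    intro c hc v
    refine le_antisymm (hom_le c hc v) ?_
    have := hom_le c⁻¹ (inv_pos.mpr hc) (c • v)
    rw [smul_smul, inv_mul_cancel₀ hc.ne', one_smul] at this
    rwa [inv_mul_eq_div, le_div_iff₀' hc] at this
  have N_add : ∀ v v', N (v + v') ≤ N v + N v' := by
    intro v v'
    rw [← sub_le_iff_le_add]
    refine le_csInf (hne v) ?_
    rintro _ ⟨φ, ψ, h, rfl⟩
    rw [sub_le_comm]
    refine le_csInf (hne v') ?_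
    rintro _ ⟨φ', ψ', h', rfl⟩
    rw [sub_le_iff_le_add]
    refine (hle (v + v') (φ' + φ) (ψ' + ψ) fun a b => ?_).trans_eq ?_
    · simp only [Pi.add_apply]; linarith [h a b, h' a b]
    · simp only [Pi.add_apply, add_mul, Finset.sum_add_distrib]; ring
  have N_zero : N 0 = 0 := by
    have := N_hom 2 (by norm_num) 0
    rw [smul_zero] at this; linarith
  have H : ∀ c : ℝ, c • u = 0 → c • N u = 0 := by
    intro c hc
    rcases smul_eq_zero.mp hc with h | h
    · simp [h]
    · simp [h, N_zero]
  obtain ⟨g, hg, hgN⟩ := exists_extension_of_le_sublinear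
    (LinearPMap.mkSpanSingleton' u (N u) H) N N_hom N_add (by
      rintro ⟨x, hx⟩
      obtain ⟨c, rfl⟩ := Submodule.mem_span_singleton.mp hx
      rw [LinearPMap.mkSpanSingleton'_apply]
      -- Only negative `c` uses subadditivity: `0 = N 0 ≤ N (c • u) + N (-c • u)`.
      rcases lt_trichotomy c 0 with h | h | h
      · have h1 := N_hom (-c) (by linarith) u
        have h2 := N_add (c • u) ((-c) • u)
        rw [← add_smul, add_neg_cancel, zero_smul, N_zero, h1] at h2
        simp only [smul_eq_mul, RingHom.id_apply]; linarith
      · simp [h, N_zero]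
      · simp [N_hom c h])
  have hgu : g u = N u := by
    have := hg ⟨u, Submodule.mem_span_singleton_self u⟩
    exact this.trans (LinearPMap.mkSpanSingleton'_apply_self u (N u) H _)
  have hsum : ∀ v : V × V → ℝ,
      g v = ∑ a, ∑ b, v (a, b) * g (fun j => if (a, b) = j then 1 else 0) := by
    intro v
    rw [LinearMap.pi_apply_eq_sum_univ g v, Fintype.sum_prod_type]
    rfl
  have hg_le : ∀ (v : V × V → ℝ) (φ ψ : V → ℝ), (∀ a b, v (a, b) ≤ φ a + ψ b) →
      g v ≤ ∑ a, φ a * μ a + ∑ b, ψ b * ν b := fun v φ ψ h => (hgN v).trans (hle v φ ψ h)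
  -- On a sum `φ a + ψ b` the upper bound also holds for the negative, so it is an equality; this
  -- fixes the marginals.
  have hg_eq : ∀ (v : V × V → ℝ) (φ ψ : V → ℝ), (∀ a b, v (a, b) = φ a + ψ b) →
      g v = ∑ a, φ a * μ a + ∑ b, ψ b * ν b := by
    intro v φ ψ h
    refine le_antisymm (hg_le v φ ψ fun a b => (h a b).le) ?_
    have := hg_le (-v) (-φ) (-ψ) fun a b => by simp [h a b, add_comm]
    simp only [map_neg, Pi.neg_apply, neg_mul, Finset.sum_neg_distrib] at this
    linarith
  refine ⟨fun a b => g (fun j => if (a, b) = j then 1 else 0), ⟨fun a b => ?_, fun a => ?_,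
    fun b => ?_⟩, by rw [← hsum, hgu]⟩
  -- Nonnegativity: the negative of an indicator is dominated by the zero pair.
  · have := hg_le (-(fun j => if (a, b) = j then 1 else 0)) 0 0 fun x y => by
      simp only [Pi.neg_apply, Pi.zero_apply, add_zero, Left.neg_nonpos_iff]
      split_ifs <;> norm_num
    simpa using this
  · have h1 := hsum fun j => if j.1 = a then 1 else 0
    rw [hg_eq _ (fun x => if x = a then 1 else 0) 0 (by simp)] at h1
    simpa [← Finset.mul_sum] using h1.symm
  · have h1 := hsum fun j => if j.2 = b then 1 else 0
    rw [hg_eq _ 0 (fun x => if x = b then 1 else 0) (by simp)] at h1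
    simpa using h1.symm

lemma exists_isCoupling {μ ν : V → ℝ} (hμ : ∀ a, 0 ≤ μ a) (hν : ∀ a, 0 ≤ ν a)
    (hμ1 : ∑ a, μ a = 1) (hν1 : ∑ a, ν a = 1) : ∃ π, IsCoupling μ ν π := by
  refine ⟨fun a b => μ a * ν b, fun a b => mul_nonneg (hμ a) (hν b), fun a => ?_, fun b => ?_⟩
  · rw [← Finset.mul_sum, hν1, mul_one]
  · rw [← Finset.sum_mul, hμ1, one_mul]

lemma IsLip.sum_le_cost {d : V → V → ℝ} {f : V → ℝ} (hf : IsLip d f) {μ ν : V → ℝ}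
    {π : V → V → ℝ} (hπ : IsCoupling μ ν π) :
    ∑ z, f z * μ z - ∑ z, f z * ν z ≤ ∑ a, ∑ b, d a b * π a b := by
  have h1 : ∑ z, f z * μ z = ∑ a, ∑ b, f a * π a b := by
    simp_rw [← Finset.mul_sum, hπ.fst_marginal]
  have h2 : ∑ z, f z * ν z = ∑ a, ∑ b, f b * π a b := by
    rw [Finset.sum_comm]
    simp_rw [← Finset.mul_sum, hπ.snd_marginal]
  rw [h1, h2, ← Finset.sum_sub_distrib]
  refine Finset.sum_le_sum fun a _ => ?_
  rw [← Finset.sum_sub_distrib]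
  refine Finset.sum_le_sum fun b _ => ?_
  rw [← sub_mul]
  exact mul_le_mul_of_nonneg_right (hf a b) (hπ.nonneg a b)

lemma IsLip.le_transportDist {d : V → V → ℝ} {f : V → ℝ} (hf : IsLip d f)
    {μ ν : V → ℝ} (hμ : ∀ a, 0 ≤ μ a) (hν : ∀ a, 0 ≤ ν a)
    (hμ1 : ∑ a, μ a = 1) (hν1 : ∑ a, ν a = 1) :
    ∑ z, f z * μ z - ∑ z, f z * ν z ≤ transportDist d μ ν := by
  obtain ⟨π, hπ⟩ := exists_isCoupling hμ hν hμ1 hν1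
  refine le_csInf ⟨_, π, hπ, rfl⟩ ?_
  rintro _ ⟨π, hπ, rfl⟩
  exact hf.sum_le_cost hπ

/-- The hard half of duality. A dual pair for the cost `-d` satisfies `-φ ≤ infConv d ψ ≤ ψ`, so the
single Lipschitz function `infConv d ψ` does at least as well as the pair. -/
lemma transportDist_le {d : V → V → ℝ} (hd : IsPseudoMetric d) {μ ν : V → ℝ}
    (hμ : ∀ a, 0 ≤ μ a) (hν : ∀ a, 0 ≤ ν a) (hμ1 : ∑ a, μ a = 1) (hν1 : ∑ a, ν a = 1) {B : ℝ}
    (hB : ∀ f, IsLip d f → ∑ z, f z * μ z - ∑ z, f z * ν z ≤ B) : transportDist d μ ν ≤ B := by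
  obtain ⟨π, hπ, hcost⟩ := exists_coupling_cost_eq_sInf hμ hν hμ1 hν1 (fun j => -d j.1 j.2)
  have hle : transportDist d μ ν ≤ ∑ a, ∑ b, d a b * π a b := by
    refine csInf_le ⟨0, ?_⟩ ⟨π, hπ, rfl⟩
    rintro _ ⟨π', hπ', rfl⟩
    exact Finset.sum_nonneg fun a _ => Finset.sum_nonneg fun b _ =>
      mul_nonneg (hd.nonneg a b) (hπ'.nonneg a b)
  refine hle.trans ?_
  simp only [neg_mul, Finset.sum_neg_distrib] at hcost
  rw [← neg_le_neg_iff, hcost]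
  refine le_csInf (dualValues_nonempty _ _ _) ?_
  rintro _ ⟨φ, ψ, h, rfl⟩
  refine (neg_le_neg (hB _ (isLip_infConv hd ψ))).trans ?_
  have h1 : ∑ z, -φ z * μ z ≤ ∑ z, infConv d ψ z * μ z := by
    refine Finset.sum_le_sum fun z _ => mul_le_mul_of_nonneg_right ?_ (hμ z)
    have : Nonempty V := ⟨z⟩
    exact le_ciInf fun v => by linarith [h z v]
  have h2 : ∑ z, infConv d ψ z * ν z ≤ ∑ z, ψ z * ν z := by
    refine Finset.sum_le_sum fun z _ => mul_le_mul_of_nonneg_right ?_ (hν z)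
    linarith [infConv_le d ψ z z, hd.self z]
  simp only [neg_mul, Finset.sum_neg_distrib] at h1
  linarith

end Transport

end RicciFlow

namespace RicciFlow

/-! ### The path metric and its dependence on the weights. -/

section Metric

variable {V : Type*} {G : SimpleGraph V}

lemma weight_eq (w : G.edgeSet → ℝ) {x y : V} (h : G.Adj x y) :
    weight w s(x, y) = w ⟨s(x, y), G.mem_edgeSet.mpr h⟩ :=
  dif_pos (G.mem_edgeSet.mpr h)

lemma weight_nonneg {w : G.edgeSet → ℝ} (hw : ∀ e, 0 < w e) (e : Sym2 V) : 0 ≤ weight w e := by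
  unfold weight
  split_ifs
  exacts [(hw _).le, le_rfl]

lemma abs_weight_sub_le {w w' : G.edgeSet → ℝ} {ε : ℝ} (hε : 0 ≤ ε)
    (h : ∀ e, |w e - w' e| ≤ ε) (e : Sym2 V) : |weight w e - weight w' e| ≤ ε := by
  unfold weight
  split_ifs
  · exact h _
  · simpa using hε

lemma length_nonneg {w : G.edgeSet → ℝ} (hw : ∀ e, 0 < w e) {x y : V} (p : G.Walk x y) :
    0 ≤ length w p := by
  refine List.sum_nonneg fun c hc => ?_
  obtain ⟨e, -, rfl⟩ := List.mem_map.mp hc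
  exact weight_nonneg hw e

lemma bddBelow_range_length {w : G.edgeSet → ℝ} (hw : ∀ e, 0 < w e) (x y : V) :
    BddBelow (Set.range fun p : G.Path x y => length w p.1) :=
  ⟨0, by rintro _ ⟨p, rfl⟩; exact length_nonneg hw p.1⟩

lemma pathDist_nonneg {w : G.edgeSet → ℝ} (hw : ∀ e, 0 < w e) (x y : V) : 0 ≤ dist w x y :=
  Real.iInf_nonneg fun p => length_nonneg hw p.1

lemma dist_le_length {w : G.edgeSet → ℝ} (hw : ∀ e, 0 < w e) {x y : V} (p : G.Walk x y) :
    dist w x y ≤ length w p := by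
  classical
  refine (ciInf_le (bddBelow_range_length hw x y) ⟨p.bypass, p.bypass_isPath⟩).trans ?_
  refine List.Sublist.sum_le_sum (p.edges_bypass_sublist_edges.map _) fun c hc => ?_
  obtain ⟨e, -, rfl⟩ := List.mem_map.mp hc
  exact weight_nonneg hw e

lemma dist_le_weight {w : G.edgeSet → ℝ} (hw : ∀ e, 0 < w e) {x y : V} (h : G.Adj x y) :
    dist w x y ≤ weight w s(x, y) := by
  simpa [length] using dist_le_length hw (SimpleGraph.Walk.cons h .nil)

lemma nonempty_path (hG : G.Connected) (x y : V) : Nonempty (G.Path x y) := by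
  classical
  exact ⟨(hG x y).some.toPath⟩

lemma dist_comm_le (hG : G.Connected) {w : G.edgeSet → ℝ} (hw : ∀ e, 0 < w e) (x y : V) :
    dist w x y ≤ dist w y x := by
  have := nonempty_path hG y x
  refine le_ciInf fun p => (dist_le_length hw p.1.reverse).trans_eq ?_
  simp [length]

lemma isPseudoMetric_dist (hG : G.Connected) {w : G.edgeSet → ℝ} (hw : ∀ e, 0 < w e) :
    IsPseudoMetric (dist w) where
  self a := le_antisymm (by simpa [length] using dist_le_length hw (.nil : G.Walk a a))
    (pathDist_nonneg hw a a)
  symm a b := le_antisymm (dist_comm_le hG hw a b) (dist_comm_le hG hw b a)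
  triangle a b c := by
    have := nonempty_path hG a b
    have := nonempty_path hG b c
    rw [← sub_le_iff_le_add]
    refine le_ciInf fun p => ?_
    rw [sub_le_comm]
    refine le_ciInf fun q => ?_
    rw [sub_le_iff_le_add']
    simpa [length] using dist_le_length hw (p.1.append q.1)

lemma dist_pos [Finite V] (hG : G.Connected) {w : G.edgeSet → ℝ} (hw : ∀ e, 0 < w e) {x y : V}
    (h : G.Adj x y) : 0 < dist w x y := by
  have : Nonempty G.edgeSet := ⟨⟨s(x, y), G.mem_edgeSet.mpr h⟩⟩
  have : Finite G.edgeSet := inferInstance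
  obtain ⟨e₀, he₀⟩ := Finite.exists_min w
  have := nonempty_path hG x y
  refine (hw e₀).trans_le (le_ciInf fun p => ?_)
  obtain ⟨p, -⟩ := p
  cases p with
  | nil => exact absurd h G.irrefl
  | cons h' p =>
    have h1 := he₀ ⟨_, G.mem_edgeSet.mpr h'⟩
    rw [← weight_eq w h'] at h1
    have h2 := length_nonneg hw p
    simp only [length, SimpleGraph.Walk.edges_cons, List.map_cons, List.sum_cons] at h2 ⊢
    linarith

/-- A path does not repeat vertices, so it has fewer than `card V` edges and the error is uniform
over all paths. -/
lemma length_le_add [Fintype V] {w w' : G.edgeSet → ℝ} {ε : ℝ} (hε : 0 ≤ ε)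
    (h : ∀ e, |w e - w' e| ≤ ε) {x y : V} (p : G.Path x y) :
    length w p.1 ≤ length w' p.1 + Fintype.card V * ε := by
  have key : ∀ l : List (Sym2 V),
      (l.map (weight w)).sum ≤ (l.map (weight w')).sum + l.length * ε := by
    intro l
    induction l with
    | nil => simp
    | cons e l ih =>
      simp only [List.map_cons, List.sum_cons, List.length_cons, Nat.cast_add, Nat.cast_one]
      linarith [(abs_le.mp (abs_weight_sub_le hε h e)).2]
  refine (key _).trans ?_
  have : (p.1.edges.length : ℝ) ≤ Fintype.card V := by
    rw [SimpleGraph.Walk.length_edges]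
    exact_mod_cast p.2.length_lt.le
  unfold length
  gcongr

lemma abs_dist_sub_le [Fintype V] (hG : G.Connected) {w w' : G.edgeSet → ℝ} (hw : ∀ e, 0 < w e)
    (hw' : ∀ e, 0 < w' e) {ε : ℝ} (hε : 0 ≤ ε) (h : ∀ e, |w e - w' e| ≤ ε) (x y : V) :
    |dist w x y - dist w' x y| ≤ Fintype.card V * ε := by
  have key : ∀ {u v : G.edgeSet → ℝ}, (∀ e, 0 < u e) → (∀ e, |u e - v e| ≤ ε) →
      dist u x y - dist v x y ≤ Fintype.card V * ε := by
    intro u v hu huv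
    have := nonempty_path hG x y
    rw [sub_le_comm]
    refine le_ciInf fun p => ?_
    linarith [ciInf_le (bddBelow_range_length hu x y) p, length_le_add hε huv p,
      show dist u x y = ⨅ p : G.Path x y, length u p.1 from rfl]
  rw [abs_le]
  constructor
  · linarith [key hw' fun e => by rw [abs_sub_comm]; exact h e]
  · exact key hw h

lemma IsLip.sub_le_weight {w : G.edgeSet → ℝ} (hw : ∀ e, 0 < w e) {f : V → ℝ}
    (hf : IsLip (dist w) f) {x z : V} (h : G.Adj x z) : f x - f z ≤ weight w s(x, z) :=
  (hf x z).trans (dist_le_weight hw h)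

/-- The distance to `y`, truncated at `dist w x y`. The truncation gives the bounds on values from
which `neg_weight_le_flowRate` follows. -/
lemma potentials_nonempty (hG : G.Connected) {w : G.edgeSet → ℝ} (hw : ∀ e, 0 < w e) (x y : V) :
    ∃ f ∈ potentials (dist w) x y, ∀ z, 0 ≤ f z ∧ f z ≤ dist w x y := by
  have hd := isPseudoMetric_dist hG hw
  refine ⟨fun z => min (dist w z y) (dist w x y), ⟨IsLip.min (fun a b => ?_) (fun a b => ?_), ?_⟩,
    fun z => ⟨le_min (hd.nonneg _ _) (hd.nonneg _ _), min_le_right _ _⟩⟩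
  · linarith [hd.triangle a b y]
  · simpa using hd.nonneg a b
  · simp [hd.self, hd.nonneg x y]

lemma weight_le_sum [Fintype G.edgeSet] {w : G.edgeSet → ℝ} (hw : ∀ e, 0 < w e) {x y : V}
    (h : G.Adj x y) : weight w s(x, y) ≤ ∑ e, w e := by
  rw [weight_eq w h]
  exact Finset.single_le_sum (fun e _ => (hw e).le) (Finset.mem_univ _)

end Metric

/-! ### The random walk and its Laplacian. -/

section RandomWalk

variable {V : Type*} [Fintype V] {G : SimpleGraph V}

open Classical in
/-- The sum of the weights of the edges at `x`. -/
noncomputable def weightedDegree (w : G.edgeSet → ℝ) (x : V) : ℝ :=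
  ∑ y ∈ Finset.univ.filter (fun y => G.Adj y x), weight w s(y, x)

open Classical in
/-- The transition probability from `x` to `z` of the random walk. -/
noncomputable def transition (w : G.edgeSet → ℝ) (x z : V) : ℝ :=
  if G.Adj z x then weight w s(z, x) / weightedDegree w x else 0

lemma transition_of_not_adj (w : G.edgeSet → ℝ) {x z : V} (h : ¬ G.Adj z x) :
    transition w x z = 0 := if_neg h

lemma weight_le_weightedDegree {w : G.edgeSet → ℝ} (hw : ∀ e, 0 < w e) {x z : V}
    (h : G.Adj z x) : weight w s(z, x) ≤ weightedDegree w x := by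
  classical
  exact Finset.single_le_sum (f := fun y => weight w s(y, x)) (fun y _ => weight_nonneg hw _)
    (by simpa using h)

lemma weightedDegree_nonneg {w : G.edgeSet → ℝ} (hw : ∀ e, 0 < w e) (x : V) :
    0 ≤ weightedDegree w x :=
  Finset.sum_nonneg fun _ _ => weight_nonneg hw _

lemma weightedDegree_pos {w : G.edgeSet → ℝ} (hw : ∀ e, 0 < w e) {x z : V} (h : G.Adj z x) :
    0 < weightedDegree w x :=
  (weight_eq w h ▸ hw _).trans_le (weight_le_weightedDegree hw h)

lemma transition_nonneg {w : G.edgeSet → ℝ} (hw : ∀ e, 0 < w e) (x z : V) :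
    0 ≤ transition w x z := by
  unfold transition
  split_ifs
  exacts [div_nonneg (weight_nonneg hw _) (weightedDegree_nonneg hw x), le_rfl]

lemma sum_transition {w : G.edgeSet → ℝ} (hw : ∀ e, 0 < w e) {x y : V} (h : G.Adj y x) :
    ∑ z, transition w x z = 1 := by
  classical
  unfold transition
  rw [← Finset.sum_filter, ← Finset.sum_div]
  convert div_self (weightedDegree_pos hw h).ne'
  unfold weightedDegree
  congr

lemma walkMeasure_eq (w : G.edgeSet → ℝ) (α : ℝ) (u z : V) [Decidable (z = u)] :
    walkMeasure w α u z = (if z = u then α else 0) + (1 - α) * transition w u z := by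
  classical
  unfold walkMeasure
  by_cases h : z = u
  · subst h
    simp [transition_of_not_adj]
  · simp only [h, if_false, zero_add, transition]
    split_ifs with h1
    · rfl
    · simp

lemma walkMeasure_nonneg {w : G.edgeSet → ℝ} (hw : ∀ e, 0 < w e) {α : ℝ} (h0 : 0 ≤ α)
    (h1 : α ≤ 1) (u z : V) : 0 ≤ walkMeasure w α u z := by
  classical
  rw [walkMeasure_eq]
  have := mul_nonneg (sub_nonneg.mpr h1) (transition_nonneg hw u z)
  split_ifs <;> linarith

/-- The random walk Laplacian. -/
noncomputable def laplacian (w : G.edgeSet → ℝ) (f : V → ℝ) (x : V) : ℝ :=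
  ∑ z, transition w x z * (f z - f x)

/-- This is how `α` is separated from `f`: the dual objective becomes affine in `1 - α`. -/
lemma sum_mul_walkMeasure {w : G.edgeSet → ℝ} (hw : ∀ e, 0 < w e) {x y : V} (h : G.Adj y x)
    (α : ℝ) (f : V → ℝ) :
    ∑ z, f z * walkMeasure w α x z = f x + (1 - α) * laplacian w f x := by
  classical
  have h1 := sum_transition hw h
  have h2 : laplacian w f x = ∑ z, transition w x z * f z - f x := by
    simp only [laplacian, mul_sub, Finset.sum_sub_distrib, ← Finset.sum_mul, h1, one_mul]
  have h3 : ∑ z, f z * ((1 - α) * transition w x z) =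
      (1 - α) * ∑ z, transition w x z * f z := by
    rw [Finset.mul_sum]
    exact Finset.sum_congr rfl fun z _ => by ring
  simp only [walkMeasure_eq, mul_add, Finset.sum_add_distrib, h3, h2]
  simp
  ring

lemma sum_walkMeasure {w : G.edgeSet → ℝ} (hw : ∀ e, 0 < w e) {x y : V} (h : G.Adj y x)
    (α : ℝ) : ∑ z, walkMeasure w α x z = 1 := by
  simpa [laplacian] using sum_mul_walkMeasure hw h α fun _ => 1

lemma laplacian_le {w : G.edgeSet → ℝ} (hw : ∀ e, 0 < w e) {x y : V} (h : G.Adj y x) {f : V → ℝ}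
    {c : ℝ} (hf : ∀ z, G.Adj z x → f z - f x ≤ c) : laplacian w f x ≤ c := by
  rw [← one_mul c, ← sum_transition hw h, Finset.sum_mul]
  refine Finset.sum_le_sum fun z _ => ?_
  by_cases hz : G.Adj z x
  · exact mul_le_mul_of_nonneg_left (hf z hz) (transition_nonneg hw x z)
  · simp [transition_of_not_adj w hz]

lemma laplacian_neg (w : G.edgeSet → ℝ) (f : V → ℝ) (x : V) :
    laplacian w (-f) x = -laplacian w f x := by
  simp only [laplacian, ← Finset.sum_neg_distrib, Pi.neg_apply]
  exact Finset.sum_congr rfl fun z _ => by ring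

lemma laplacian_sub (w : G.edgeSet → ℝ) (f g : V → ℝ) (x : V) :
    laplacian w (f - g) x = laplacian w f x - laplacian w g x := by
  simp only [laplacian, ← Finset.sum_sub_distrib, Pi.sub_apply]
  exact Finset.sum_congr rfl fun z _ => by ring

lemma laplacian_sub_le {w : G.edgeSet → ℝ} (hw : ∀ e, 0 < w e) {x y : V} (h : G.Adj y x)
    {f g : V → ℝ} {δ : ℝ} (hfg : ∀ z, |f z - g z| ≤ δ) :
    |laplacian w f x - laplacian w g x| ≤ 2 * δ := by
  rw [← laplacian_sub, abs_le, neg_le, ← laplacian_neg]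
  constructor <;> refine laplacian_le hw h fun z _ => ?_
  · simp only [Pi.neg_apply, Pi.sub_apply]
    linarith [abs_le.mp (hfg z), abs_le.mp (hfg x)]
  · simp only [Pi.sub_apply]
    linarith [abs_le.mp (hfg z), abs_le.mp (hfg x)]

lemma abs_weightedDegree_sub_le {w w' : G.edgeSet → ℝ} {ε : ℝ} (hε : 0 ≤ ε)
    (h : ∀ e, |w e - w' e| ≤ ε) (x : V) :
    |weightedDegree w x - weightedDegree w' x| ≤ Fintype.card V * ε := by
  classical
  unfold weightedDegree
  rw [← Finset.sum_sub_distrib]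
  refine (Finset.abs_sum_le_sum_abs _ _).trans ?_
  refine (Finset.sum_le_card_nsmul _ _ ε fun y _ => abs_weight_sub_le hε h _).trans ?_
  rw [nsmul_eq_mul]
  gcongr
  exact Finset.card_filter_le _ _

lemma abs_transition_sub_le {w w' : G.edgeSet → ℝ} {a : ℝ} (ha : 0 < a) (hw : ∀ e, a ≤ w e)
    (hw' : ∀ e, a ≤ w' e) {ε : ℝ} (hε : 0 ≤ ε) (h : ∀ e, |w e - w' e| ≤ ε) {x z : V}
    (hz : G.Adj z x) :
    |transition w x z - transition w' x z| ≤ (Fintype.card V + 1) * ε / a := by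
  have hw0 : ∀ e, 0 < w e := fun e => ha.trans_le (hw e)
  have hw0' : ∀ e, 0 < w' e := fun e => ha.trans_le (hw' e)
  have hD := weightedDegree_pos hw0 hz
  have hD' := weightedDegree_pos hw0' hz
  have haD : a ≤ weightedDegree w x :=
    (weight_eq w hz ▸ hw _ : a ≤ weight w s(z, x)).trans (weight_le_weightedDegree hw0 hz)
  have hq0 : 0 ≤ weight w' s(z, x) / weightedDegree w' x :=
    div_nonneg (weight_nonneg hw0' _) hD'.le
  have hq1 : weight w' s(z, x) / weightedDegree w' x ≤ 1 :=
    (div_le_one hD').mpr (weight_le_weightedDegree hw0' hz)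
  -- In this form the coefficient of the degree difference is a ratio at most `1`, and the only
  -- remaining denominator is at least `a`.
  have e : transition w x z - transition w' x z =
      ((weight w s(z, x) - weight w' s(z, x)) +
        weight w' s(z, x) / weightedDegree w' x * (weightedDegree w' x - weightedDegree w x)) /
        weightedDegree w x := by
    simp only [transition, if_pos hz]
    field_simp
    ring
  rw [e, abs_div, abs_of_pos hD]
  gcongr
  refine (abs_add_le _ _).trans ?_
  rw [abs_mul, abs_of_nonneg hq0]
  have h1 := abs_weight_sub_le hε h s(z, x)
  have h2 := abs_weightedDegree_sub_le hε h x
  rw [abs_sub_comm] at h2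
  have h3 := mul_le_mul hq1 h2 (abs_nonneg _) zero_le_one
  linarith

lemma abs_laplacian_sub_le {w w' : G.edgeSet → ℝ} {a b : ℝ} (ha : 0 < a) (hb : 0 ≤ b)
    (hw : ∀ e, a ≤ w e) (hwb : ∀ e, w e ≤ b)
    (hw' : ∀ e, a ≤ w' e) {ε : ℝ} (hε : 0 ≤ ε) (h : ∀ e, |w e - w' e| ≤ ε) {f : V → ℝ}
    (hf : IsLip (dist w) f) (x : V) :
    |laplacian w f x - laplacian w' f x| ≤
      Fintype.card V * ((Fintype.card V + 1) * ε / a * b) := by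
  have hw0 : ∀ e, 0 < w e := fun e => ha.trans_le (hw e)
  unfold laplacian
  rw [← Finset.sum_sub_distrib]
  refine (Finset.abs_sum_le_sum_abs _ _).trans ?_
  refine (Finset.sum_le_card_nsmul _ _ ((Fintype.card V + 1) * ε / a * b) fun z _ => ?_).trans_eq
    (by rw [nsmul_eq_mul, Finset.card_univ])
  rw [← sub_mul, abs_mul]
  by_cases hz : G.Adj z x
  · refine mul_le_mul (abs_transition_sub_le ha hw hw' hε h hz) ?_ (abs_nonneg _) (by positivity)
    have h1 := hf.sub_le_weight hw0 hz
    have h2 := hf.sub_le_weight hw0 hz.symm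
    rw [weight_eq w hz] at h1
    rw [weight_eq w hz.symm] at h2
    rw [abs_le]
    constructor <;> linarith [hwb ⟨_, G.mem_edgeSet.mpr hz⟩, hwb ⟨_, G.mem_edgeSet.mpr hz.symm⟩]
  · simp only [transition_of_not_adj _ hz, sub_self, abs_zero, zero_mul]
    positivity

/-! ### The flow rate: growth bounds, symmetry and Lipschitz dependence. -/

/-- The rate of change of the weight of the edge `xy` under the flow. -/
noncomputable def flowRate (w : G.edgeSet → ℝ) (x y : V) : ℝ :=
  sSup ((fun f => laplacian w f x - laplacian w f y) '' potentials (dist w) x y)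

lemma flowRate_image_nonempty (hG : G.Connected) {w : G.edgeSet → ℝ} (hw : ∀ e, 0 < w e)
    (x y : V) :
    ((fun f => laplacian w f x - laplacian w f y) '' potentials (dist w) x y).Nonempty := by
  obtain ⟨f, hf, -⟩ := potentials_nonempty hG hw x y
  exact ⟨_, f, hf, rfl⟩

lemma laplacian_sub_laplacian_le [Fintype G.edgeSet] {w : G.edgeSet → ℝ} (hw : ∀ e, 0 < w e)
    {x y : V} (h : G.Adj x y) {f : V → ℝ} (hf : IsLip (dist w) f) :
    laplacian w f x - laplacian w f y ≤ 2 * ∑ e, w e := by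
  have h1 : laplacian w f x ≤ ∑ e, w e := laplacian_le hw h.symm fun z hz =>
    (hf.sub_le_weight hw hz).trans (weight_le_sum hw hz)
  have h2 : laplacian w (-f) y ≤ ∑ e, w e := laplacian_le hw h fun z hz => by
    have := (hf.sub_le_weight hw hz.symm).trans (weight_le_sum hw hz.symm)
    simp only [Pi.neg_apply]
    linarith
  rw [laplacian_neg] at h2
  linarith

lemma flowRate_image_bddAbove {w : G.edgeSet → ℝ} (hw : ∀ e, 0 < w e) {x y : V}
    (h : G.Adj x y) :
    BddAbove ((fun f => laplacian w f x - laplacian w f y) '' potentials (dist w) x y) := by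
  have := Fintype.ofFinite G.edgeSet
  refine ⟨2 * ∑ e, w e, ?_⟩
  rintro _ ⟨f, hf, rfl⟩
  exact laplacian_sub_laplacian_le hw h hf.1

lemma le_flowRate {w : G.edgeSet → ℝ} (hw : ∀ e, 0 < w e) {x y : V} (h : G.Adj x y) {f : V → ℝ}
    (hf : f ∈ potentials (dist w) x y) :
    laplacian w f x - laplacian w f y ≤ flowRate w x y :=
  le_csSup (flowRate_image_bddAbove hw h) ⟨f, hf, rfl⟩

lemma flowRate_le (hG : G.Connected) {w : G.edgeSet → ℝ} (hw : ∀ e, 0 < w e) {x y : V} {c : ℝ}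
    (hc : ∀ f ∈ potentials (dist w) x y, laplacian w f x - laplacian w f y ≤ c) :
    flowRate w x y ≤ c := by
  refine csSup_le (flowRate_image_nonempty hG hw x y) ?_
  rintro _ ⟨f, hf, rfl⟩
  exact hc f hf

lemma flowRate_le_sum [Fintype G.edgeSet] (hG : G.Connected) {w : G.edgeSet → ℝ}
    (hw : ∀ e, 0 < w e) {x y : V} (h : G.Adj x y) : flowRate w x y ≤ 2 * ∑ e, w e :=
  flowRate_le hG hw fun _ hf => laplacian_sub_laplacian_le hw h hf.1

/-- A supremum is bounded below by one test potential. With values in `[0, d x y]`, its increments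
are at most `d x y` in size, so each Laplacian contributes at least `-d x y`, and `d x y` is at most
the weight. This prevents extinction in finite time. -/
lemma neg_weight_le_flowRate (hG : G.Connected) {w : G.edgeSet → ℝ} (hw : ∀ e, 0 < w e) {x y : V}
    (h : G.Adj x y) : -2 * weight w s(x, y) ≤ flowRate w x y := by
  obtain ⟨f, hf, hb⟩ := potentials_nonempty hG hw x y
  refine le_trans ?_ (le_flowRate hw h hf)
  have h1 : laplacian w (-f) x ≤ dist w x y := laplacian_le hw h.symm fun z _ => by
    simp only [Pi.neg_apply]
    linarith [(hb z).1, (hb x).2]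
  have h2 : laplacian w f y ≤ dist w x y := laplacian_le hw h fun z _ => by
    linarith [(hb z).2, (hb y).1]
  rw [laplacian_neg] at h1
  linarith [dist_le_weight hw h]

/-- Negation maps potentials from `x` to `y` onto potentials from `y` to `x`. -/
lemma flowRate_le_swap (hG : G.Connected) {w : G.edgeSet → ℝ} (hw : ∀ e, 0 < w e) {x y : V}
    (h : G.Adj x y) : flowRate w x y ≤ flowRate w y x := by
  refine flowRate_le hG hw fun f hf => ?_
  have hd := isPseudoMetric_dist hG hw
  have : -f ∈ potentials (dist w) y x := by
    refine ⟨fun a b => ?_, ?_⟩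
    · simp only [Pi.neg_apply]
      linarith [hf.1 b a, hd.symm a b]
    · simp only [Pi.neg_apply]
      linarith [hf.2, hd.symm x y]
  have := le_flowRate hw h.symm this
  simp only [laplacian_neg] at this
  linarith

lemma flowRate_comm (hG : G.Connected) {w : G.edgeSet → ℝ} (hw : ∀ e, 0 < w e) {x y : V}
    (h : G.Adj x y) : flowRate w x y = flowRate w y x :=
  le_antisymm (flowRate_le_swap hG hw h) (flowRate_le_swap hG hw h.symm)

/-- On a box of positive weights the flow rate is Lipschitz in the weight. -/
lemma flowRate_le_add (hG : G.Connected) {w w' : G.edgeSet → ℝ} {a b : ℝ} (ha : 0 < a)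
    (hb : 0 ≤ b) (hw : ∀ e, a ≤ w e) (hwb : ∀ e, w e ≤ b) (hw' : ∀ e, a ≤ w' e) {ε : ℝ}
    (hε : 0 ≤ ε) (hww : ∀ e, |w e - w' e| ≤ ε) {x y : V} (h : G.Adj x y) :
    flowRate w x y ≤ flowRate w' x y +
      (2 * Fintype.card V * ((Fintype.card V + 1) * b / a) + 8 * Fintype.card V) * ε := by
  have hw0 : ∀ e, 0 < w e := fun e => ha.trans_le (hw e)
  have hw0' : ∀ e, 0 < w' e := fun e => ha.trans_le (hw' e)
  refine flowRate_le hG hw0 fun f hf => ?_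
  -- The metrics differ by at most `card V * ε`, so `f'` is within twice that of `f`. Each of the
  -- two Laplacians doubles the error again, whence the `8 * card V`.
  obtain ⟨f', hf', hff⟩ := exists_potential_near (isPseudoMetric_dist hG hw0')
    (ε := Fintype.card V * ε) (η := 0) (by positivity) le_rfl
    (abs_dist_sub_le hG hw0 hw0' hε hww) hf.1 (x := x) (y := y) (by simp [hf.2])
  have h1 := (abs_le.mp (abs_laplacian_sub_le ha hb hw hwb hw' hε hww hf.1 x)).2
  have h2 := (abs_le.mp (abs_laplacian_sub_le ha hb hw hwb hw' hε hww hf.1 y)).1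
  have h3 := (abs_le.mp (laplacian_sub_le hw0' h.symm hff)).1
  have h4 := (abs_le.mp (laplacian_sub_le hw0' h hff)).2
  have h5 := le_flowRate hw0' h hf'
  have e : (2 * Fintype.card V * ((Fintype.card V + 1) * b / a) + 8 * Fintype.card V) * ε =
      2 * (Fintype.card V * ((Fintype.card V + 1) * ε / a * b)) + 8 * (Fintype.card V * ε) := by
    ring
  rw [e]
  linarith

/-! ### Identification of the curvature with the flow rate. -/

/-- For `α` near `1` the transportation distance is affine in `α`. -/
theorem transportDist_walkMeasure (hG : G.Connected) {w : G.edgeSet → ℝ} (hw : ∀ e, 0 < w e)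
    {x y : V} (h : G.Adj x y) {α : ℝ} (hα : 3 / 4 ≤ α) (hα1 : α < 1) :
    transportDist (dist w) (walkMeasure w α x) (walkMeasure w α y) =
      dist w x y + (1 - α) * flowRate w x y := by
  have hd := isPseudoMetric_dist hG hw
  have hα0 : 0 ≤ α := by linarith
  have hx := walkMeasure_nonneg hw hα0 hα1.le x
  have hy := walkMeasure_nonneg hw hα0 hα1.le y
  have hx1 := sum_walkMeasure hw h.symm α
  have hy1 := sum_walkMeasure hw h α
  apply le_antisymm
  · refine transportDist_le hd hx hy hx1 hy1 fun f hf => ?_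
    rw [sum_mul_walkMeasure hw h.symm, sum_mul_walkMeasure hw h]
    -- Here the metric is unchanged and `η` is the defect of `f` from being a potential.
    obtain ⟨f', hf', hff⟩ := exists_potential_near hd (d := dist w) (ε := 0)
      (η := dist w x y - (f x - f y)) le_rfl (by linarith [hf x y]) (by simp) hf
      (x := x) (y := y) (by linarith)
    rw [mul_zero, zero_add] at hff
    have h3 := (abs_le.mp (laplacian_sub_le hw h.symm hff)).1
    have h4 := (abs_le.mp (laplacian_sub_le hw h hff)).2
    have h5 := le_flowRate hw h hf'
    have h6 : laplacian w f x - laplacian w f y ≤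
        flowRate w x y + 4 * (dist w x y - (f x - f y)) := by linarith
    have h7 := mul_le_mul_of_nonneg_left h6 (by linarith : 0 ≤ 1 - α)
    -- The loss `η` in `f x - f y` outweighs the possible gain `4 * (1 - α) * η`; this is the origin
    -- of the threshold `3 / 4`.
    have h8 := mul_nonneg (by linarith : 0 ≤ 1 - 4 * (1 - α))
      (by linarith [hf x y] : 0 ≤ dist w x y - (f x - f y))
    linarith
  · rw [← le_sub_iff_add_le', ← le_div_iff₀' (by linarith)]
    refine flowRate_le hG hw fun f hf => ?_
    rw [le_div_iff₀' (by linarith)]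
    have := hf.1.le_transportDist hx hy hx1 hy1
    rw [sum_mul_walkMeasure hw h.symm, sum_mul_walkMeasure hw h] at this
    linarith [hf.2]

theorem tendsto_curvatureQuotient (hG : G.Connected) {w : G.edgeSet → ℝ} (hw : ∀ e, 0 < w e)
    {x y : V} (h : G.Adj x y) :
    Tendsto (curvatureQuotient w x y) (𝓝[<] (1 : ℝ)) (𝓝 (-(flowRate w x y / dist w x y))) := by
  refine tendsto_const_nhds.congr' ?_
  have : Set.Ico (3 / 4 : ℝ) 1 ∈ 𝓝[<] (1 : ℝ) := Ico_mem_nhdsLT (by norm_num)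
  filter_upwards [this] with α hα
  have h1 : 1 - α ≠ 0 := by linarith [hα.2]
  have h2 := (dist_pos hG hw h).ne'
  rw [curvatureQuotient, transportDist_walkMeasure hG hw h hα.1 hα.2]
  field_simp
  ring

theorem curvature_eq (hG : G.Connected) {w : G.edgeSet → ℝ} (hw : ∀ e, 0 < w e)
    {x y : V} (h : G.Adj x y) : curvature w x y = -(flowRate w x y / dist w x y) :=
  (tendsto_curvatureQuotient hG hw h).limUnder_eq

theorem neg_curvature_mul_dist (hG : G.Connected) {w : G.edgeSet → ℝ} (hw : ∀ e, 0 < w e)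
    {x y : V} (h : G.Adj x y) : -(curvature w x y * dist w x y) = flowRate w x y := by
  rw [curvature_eq hG hw h, neg_mul, neg_neg, div_mul_cancel₀ _ (dist_pos hG hw h).ne']

end RandomWalk

end RicciFlow

namespace RicciFlow

/-! ### Global existence and uniqueness for tame vector fields. -/

section GlobalFlow

open Set
open scoped NNReal

variable {ι : Type*}

lemma exists_pos_forall_le [Finite ι] {f : ι → ℝ} (hf : ∀ e, 0 < f e) : ∃ a > 0, ∀ e, a ≤ f e := by
  rcases isEmpty_or_nonempty ι with h | h
  · exact ⟨1, one_pos, fun e => h.elim e⟩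
  · obtain ⟨e, he⟩ := Finite.exists_min f
    exact ⟨f e, hf e, he⟩

/-- A continuous curve of positive weights stays in a box of positive weights during a compact
time interval. -/
lemma exists_box_of_continuousOn [Fintype ι] {v : ℝ → ι → ℝ} {t : ℝ} (ht : 0 ≤ t)
    (hv : ContinuousOn v (Icc 0 t)) (hpos : ∀ s ∈ Icc 0 t, ∀ e, 0 < v s e) :
    ∃ a > 0, ∃ b, ∀ s ∈ Icc 0 t, v s ∈ Icc (fun _ => a) (fun _ => b) := by
  have hmin : ∀ e, ∃ a > 0, ∀ s ∈ Icc 0 t, a ≤ v s e := fun e => by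
    obtain ⟨s, hs, hs'⟩ := isCompact_Icc.exists_isMinOn ⟨0, left_mem_Icc.mpr ht⟩
      ((continuous_apply e).comp_continuousOn hv)
    exact ⟨v s e, hpos s hs e, fun r hr => hs' hr⟩
  choose f hf hfv using hmin
  obtain ⟨a, ha, haf⟩ := exists_pos_forall_le hf
  obtain ⟨b, hb⟩ := (isCompact_Icc.image_of_continuousOn hv).isBounded.exists_norm_le
  refine ⟨a, ha, b, fun s hs => ⟨fun e => (haf e).trans (hfv e s hs), fun e => ?_⟩⟩
  exact (le_abs_self _).trans ((norm_le_pi_norm (v s) e).trans (hb _ (mem_image_of_mem v hs)))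

/-- A vector field on the positive orthant that is Lipschitz on boxes and satisfies growth bounds
that keep its integral curves inside the orthant and prevent blow-up. -/
structure IsTameField [Fintype ι] (F : (ι → ℝ) → ι → ℝ) : Prop where
  lipschitz : ∀ a b : ℝ, 0 < a → ∃ K : ℝ≥0, LipschitzOnWith K F (Icc (fun _ => a) (fun _ => b))
  lower : ∀ w, (∀ e, 0 < w e) → ∀ e, -2 * w e ≤ F w e
  upper : ∀ w, (∀ e, 0 < w e) → ∀ e, F w e ≤ 2 * ∑ i, w i

/-- The coordinatewise projection onto the box `[a, b]^ι`. -/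
def clamp (a b : ℝ) (w : ι → ℝ) : ι → ℝ := fun e => max a (min b (w e))

lemma clamp_mem_Icc {a b : ℝ} (hab : a ≤ b) (w : ι → ℝ) :
    clamp a b w ∈ Icc (fun _ => a) (fun _ => b) :=
  ⟨fun _ => le_max_left _ _, fun _ => max_le hab (min_le_left _ _)⟩

lemma clamp_le {a b : ℝ} {w : ι → ℝ} {e : ι} (h : a ≤ w e) : clamp a b w e ≤ w e :=
  max_le h (min_le_right _ _)

lemma clamp_eq_self {a b : ℝ} {w : ι → ℝ} (ha : ∀ e, a ≤ w e) (hb : ∀ e, w e ≤ b) :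
    clamp a b w = w := by
  ext e
  rw [clamp, min_eq_right (hb e), max_eq_right (ha e)]

variable [Fintype ι] {F : (ι → ℝ) → ι → ℝ}

/-- A positive integral curve of `F` on the set `I` of times. -/
structure IsPositiveCurve (F : (ι → ℝ) → ι → ℝ) (I : Set ℝ) (w : ℝ → ι → ℝ) : Prop where
  pos : ∀ t ∈ I, ∀ e, 0 < w t e
  deriv : ∀ t ∈ I, HasDerivWithinAt w (F (w t)) I t

lemma IsPositiveCurve.mono {I J : Set ℝ} {w : ℝ → ι → ℝ} (h : IsPositiveCurve F I w)
    (hJ : J ⊆ I) : IsPositiveCurve F J w :=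
  ⟨fun t ht => h.pos t (hJ ht), fun t ht => (h.deriv t (hJ ht)).mono hJ⟩

/-- On each compact `[0, t]` with `t < T` both curves lie in a common box of positive weights, where
one Lipschitz constant serves for the standard ODE uniqueness theorem. -/
theorem IsPositiveCurve.eqOn (hF : IsTameField F) {T : ℝ} {v w : ℝ → ι → ℝ}
    (hv : IsPositiveCurve F (Ico 0 T) v) (hw : IsPositiveCurve F (Ico 0 T) w) (h0 : v 0 = w 0) :
    EqOn v w (Ico 0 T) := by
  intro t ht
  have hsub : Icc 0 t ⊆ Ico 0 T := fun s hs => ⟨hs.1, hs.2.trans_lt ht.2⟩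
  have key : ∀ {u : ℝ → ι → ℝ}, IsPositiveCurve F (Ico 0 T) u → ContinuousOn u (Icc 0 t) ∧
      (∀ s ∈ Ico 0 t, HasDerivWithinAt u (F (u s)) (Ici s) s) ∧
      ∃ a > 0, ∃ b, ∀ s ∈ Icc 0 t, u s ∈ Icc (fun _ => a) (fun _ => b) := by
    intro u hu
    have hc : ContinuousOn u (Icc 0 t) := fun s hs => ((hu.deriv s (hsub hs)).mono
      hsub).continuousWithinAt
    refine ⟨hc, fun s hs => ?_, exists_box_of_continuousOn ht.1 hc fun s hs => hu.pos s (hsub hs)⟩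
    have hs' : s ∈ Ico 0 T := ⟨hs.1, hs.2.trans ht.2⟩
    exact (hu.deriv s hs').mono_of_mem_nhdsWithin (Ico_mem_nhdsGE_of_mem hs')
  obtain ⟨hvc, hvd, a, ha, b, hvb⟩ := key hv
  obtain ⟨hwc, hwd, a', ha', b', hwb⟩ := key hw
  obtain ⟨K, hK⟩ := hF.lipschitz (min a a') (max b b') (lt_min ha ha')
  refine ODE_solution_unique_of_mem_Icc_right (v := fun _ => F)
    (s := fun _ => Icc (fun _ => min a a') (fun _ => max b b')) (fun _ _ => hK) hvc hvd
    (fun s hs => ?_) hwc hwd (fun s hs => ?_) h0 (right_mem_Icc.mpr ht.1)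
  · have := hvb s (Ico_subset_Icc_self hs)
    exact ⟨fun e => (min_le_left _ _).trans (this.1 e), fun e => (this.2 e).trans (le_max_left _ _)⟩
  · have := hwb s (Ico_subset_Icc_self hs)
    exact ⟨fun e => (min_le_right _ _).trans (this.1 e),
      fun e => (this.2 e).trans (le_max_right _ _)⟩

lemma lipschitzWith_clamp (a b : ℝ) : LipschitzWith 1 (clamp a b : (ι → ℝ) → ι → ℝ) := by
  refine LipschitzWith.of_dist_le_mul fun w w' => (dist_pi_le_iff (by positivity)).mpr fun e => ?_
  have h := ((LipschitzWith.id (α := ℝ)).const_min b).const_max a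
  refine (h.dist_le_mul (w e) (w' e)).trans ?_
  gcongr
  exact dist_le_pi_dist w w' e

/-- Global existence for a vector field truncated to a box. -/
lemma exists_integralCurve_clamp (hF : IsTameField F) {a b : ℝ} (ha : 0 < a) (hab : a ≤ b)
    {T : ℝ} (hT : 0 < T) (w₀ : ι → ℝ) :
    ∃ w : ℝ → ι → ℝ, w 0 = w₀ ∧
      ∀ t ∈ Icc 0 T, HasDerivWithinAt w (F (clamp a b (w t))) (Icc 0 T) t := by
  obtain ⟨K, hK⟩ := hF.lipschitz a b ha
  obtain ⟨L, hL⟩ := ((isCompact_Icc (a := fun _ : ι => a) (b := fun _ => b)).image_of_continuousOn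
    hK.continuousOn).isBounded.exists_norm_le
  have hlip : LipschitzWith (K * 1) fun w => F (clamp a b w) := by
    rw [← lipschitzOnWith_univ] at *
    exact hK.comp ((lipschitzWith_clamp a b).lipschitzOnWith) fun w _ => clamp_mem_Icc hab w
  -- The truncated field is globally Lipschitz and bounded by `L`, so a ball of radius `L * T`
  -- suffices for the whole interval.
  have hpl : IsPicardLindelof (fun _ : ℝ => fun w => F (clamp a b w))
      (⟨0, left_mem_Icc.mpr hT.le⟩ : Icc (0 : ℝ) T) w₀ (L.toNNReal * T.toNNReal) 0 L.toNNReal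
      (K * 1) := by
    refine IsPicardLindelof.of_time_independent (fun w _ => ?_) hlip.lipschitzOnWith ?_
    · exact (hL _ (mem_image_of_mem F (clamp_mem_Icc hab w))).trans (Real.le_coe_toNNReal L)
    · simp [hT.le]
  exact hpl.exists_eq_forall_mem_Icc_hasDerivWithinAt₀

/-- Solve the truncated equation and show that the solution never leaves the box, by comparison with
exponential barriers. -/
lemma exists_isPositiveCurve_Icc (hF : IsTameField F) {w₀ : ι → ℝ} (hw₀ : ∀ e, 0 < w₀ e)
    {T : ℝ} (hT : 0 < T) : ∃ w : ℝ → ι → ℝ, w 0 = w₀ ∧ IsPositiveCurve F (Icc 0 T) w := by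
  obtain ⟨a₀, ha₀, ha₀w⟩ := exists_pos_forall_le hw₀
  -- The rates `-3` and `card ι * 2 + 1` are one worse than the growth bounds give, because the
  -- comparison theorem needs a strict inequality at contact. The `+ 1` in `S` keeps it positive
  -- when `ι` is empty.
  set a := a₀ * Real.exp (-3 * T) with ha_def
  set M : ℝ := Fintype.card ι * 2 + 1 with hM
  set S : ℝ := ∑ e, w₀ e + 1 with hS
  have hS0 : 0 < S := by
    have : 0 ≤ ∑ e, w₀ e := Finset.sum_nonneg fun e _ => (hw₀ e).le
    linarith
  set b := max a (S * Real.exp (M * T)) with hb_def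
  have ha : 0 < a := by positivity
  have hab : a ≤ b := le_max_left _ _
  obtain ⟨w, hw0, hwd⟩ := exists_integralCurve_clamp hF ha hab hT w₀
  have hcpos : ∀ t e, 0 < clamp a b (w t) e := fun t e => ha.trans_le (le_max_left _ _)
  have hcont : ContinuousOn w (Icc 0 T) := fun t ht => (hwd t ht).continuousWithinAt
  have hright : ∀ t ∈ Ico 0 T, ∀ e,
      HasDerivWithinAt (fun s => w s e) (F (clamp a b (w t)) e) (Ici t) t := fun t ht e =>
    hasDerivWithinAt_pi.mp ((hwd t (Ico_subset_Icc_self ht)).mono_of_mem_nhdsWithin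
      (Icc_mem_nhdsGE_of_mem ht)) e
  have ha_le : ∀ t ∈ Icc 0 T, ∀ e, a ≤ w₀ e * Real.exp (-3 * t) := fun t ht e => by
    have : Real.exp (-3 * T) ≤ Real.exp (-3 * t) := Real.exp_le_exp.mpr (by linarith [ht.2])
    exact mul_le_mul (ha₀w e) this (Real.exp_pos _).le (hw₀ e).le
  have hexp : ∀ c k t : ℝ,
      HasDerivAt (fun s => c * Real.exp (k * s)) (c * (Real.exp (k * t) * k)) t := fun c k t => by
    have h1 : HasDerivAt (fun s : ℝ => k * s) k t := by simpa using (hasDerivAt_id t).const_mul k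
    exact h1.exp.const_mul c
  have hlow : ∀ t ∈ Icc 0 T, ∀ e, a ≤ w t e := by
    intro t ht e
    -- At contact the weight equals the barrier, which is at least `a`, so clamping can only lower
    -- it. Then `F ≥ -2 * clamp ≥ -2 * w > -3 * w`, with no upper bound on `w` needed.
    have := image_le_of_deriv_right_lt_deriv_boundary (f := fun s => -w s e)
      (f' := fun s => -F (clamp a b (w s)) e) (B := fun s => -w₀ e * Real.exp (-3 * s))
      (B' := fun s => -w₀ e * (Real.exp (-3 * s) * -3))
      ((continuous_apply e).comp_continuousOn hcont).neg
      (fun s hs => (hright s hs e).neg) (by simp [hw0]) (hexp _ _) (by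
        intro s hs h
        have h1 := ha_le s (Ico_subset_Icc_self hs) e
        have h2 : a ≤ w s e := by linarith
        have h3 := hF.lower _ (hcpos s) e
        have h4 := clamp_le (b := b) h2
        have h5 : 0 < w₀ e * Real.exp (-3 * s) := ha.trans_le h1
        linarith) ht
    linarith [ha_le t ht e]
  have hup : ∀ t ∈ Icc 0 T, ∑ e, w t e ≤ S * Real.exp (M * t) := by
    intro t ht
    refine image_le_of_deriv_right_lt_deriv_boundary (f := fun s => ∑ e, w s e)
      (f' := fun s => ∑ e, F (clamp a b (w s)) e) (B' := fun s => S * (Real.exp (M * s) * M))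
      (continuousOn_finsetSum _ fun e _ => (continuous_apply e).comp_continuousOn hcont)
      (fun s hs => HasDerivWithinAt.fun_sum fun e _ => hright s hs e) (by simp [hw0, hS])
      (hexp _ _) (fun s hs h => ?_) ht
    have h1 : ∑ e, F (clamp a b (w s)) e ≤ ∑ _e : ι, 2 * ∑ i, w s i :=
      Finset.sum_le_sum fun e _ => (hF.upper _ (hcpos s) e).trans
        (mul_le_mul_of_nonneg_left (Finset.sum_le_sum fun i _ =>
          clamp_le (hlow s (Ico_subset_Icc_self hs) i)) zero_le_two)
    rw [Finset.sum_const, nsmul_eq_mul, Finset.card_univ, h] at h1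
    have h2 : 0 < S * Real.exp (M * s) := by positivity
    have h3 : S * (Real.exp (M * s) * M) =
        Fintype.card ι * (2 * (S * Real.exp (M * s))) + S * Real.exp (M * s) := by rw [hM]; ring
    linarith
  have hpos : ∀ t ∈ Icc 0 T, ∀ e, 0 < w t e := fun t ht e => ha.trans_le (hlow t ht e)
  refine ⟨w, hw0, hpos, fun t ht => ?_⟩
  have : clamp a b (w t) = w t := by
    refine clamp_eq_self (hlow t ht) fun e => ?_
    refine (Finset.single_le_sum (fun i _ => (hpos t ht i).le) (Finset.mem_univ e)).trans
      ((hup t ht).trans (le_trans ?_ (le_max_right _ _)))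
    have hM0 : 0 ≤ M := by positivity
    gcongr
    exact ht.2
  simpa only [this] using hwd t ht

/-- Global existence of a positive integral curve. -/
theorem exists_isPositiveCurve_Ici (hF : IsTameField F) {w₀ : ι → ℝ} (hw₀ : ∀ e, 0 < w₀ e) :
    ∃ w : ℝ → ι → ℝ, w 0 = w₀ ∧ IsPositiveCurve F (Ici 0) w := by
  have hex : ∀ n : ℕ, ∃ w : ℝ → ι → ℝ, w 0 = w₀ ∧ IsPositiveCurve F (Ico 0 (n + 1 : ℝ)) w :=
    fun n => by
      obtain ⟨w, h0, hw⟩ := exists_isPositiveCurve_Icc hF hw₀ (T := n + 1) (by positivity)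
      exact ⟨w, h0, hw.mono Ico_subset_Icc_self⟩
  choose W hW0 hW using hex
  -- Solutions on `[0, n + 1)` agree by uniqueness, so they glue to the diagonal `t ↦ W ⌊t⌋₊ t`; the
  -- `+ 1` keeps `t` strictly inside its interval.
  have hagree : ∀ n : ℕ, EqOn (fun t => W ⌊t⌋₊ t) (W n) (Ico 0 (n + 1 : ℝ)) := fun n t ht => by
    have hle : (⌊t⌋₊ : ℝ) ≤ n := by
      exact_mod_cast Nat.lt_succ_iff.mp ((Nat.floor_lt ht.1).mpr (by exact_mod_cast ht.2))
    exact (hW ⌊t⌋₊).eqOn hF ((hW n).mono (Ico_subset_Ico_right (by linarith)))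
      (by rw [hW0, hW0]) ⟨ht.1, Nat.lt_floor_add_one t⟩
  refine ⟨fun t => W ⌊t⌋₊ t, by simp [hW0], fun t ht => ?_, fun t ht => ?_⟩
  · exact (hW ⌊t⌋₊).pos t ⟨ht, Nat.lt_floor_add_one t⟩
  · have hmem : t ∈ Ico 0 (⌊t⌋₊ + 1 : ℝ) := ⟨ht, Nat.lt_floor_add_one t⟩
    refine (((hW ⌊t⌋₊).deriv t hmem).congr (hagree ⌊t⌋₊) rfl).mono_of_mem_nhdsWithin ?_
    rw [← Ici_inter_Iio]
    exact inter_mem self_mem_nhdsWithin (mem_nhdsWithin_of_mem_nhds (Iio_mem_nhds hmem.2))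

end GlobalFlow

end RicciFlow

namespace RicciFlow

/-! ### The modified Ricci flow as a tame vector field. -/

section Flow

section Edges

variable {V : Type*} {G : SimpleGraph V}

lemma adj_out (e : G.edgeSet) : G.Adj (Quot.out e.1).1 (Quot.out e.1).2 := by
  have : s((Quot.out e.1).1, (Quot.out e.1).2) = e.1 := Quot.out_eq e.1
  rw [← SimpleGraph.mem_edgeSet, this]
  exact e.2

lemma weight_out (w : G.edgeSet → ℝ) (e : G.edgeSet) :
    weight w s((Quot.out e.1).1, (Quot.out e.1).2) = w e := by
  rw [weight_eq w (adj_out e)]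
  congr 1
  exact Subtype.ext (Quot.out_eq e.1)

end Edges

variable {V : Type*} [Fintype V] {G : SimpleGraph V}

/-- The vector field of the modified Ricci flow. -/
noncomputable def flowField (w : G.edgeSet → ℝ) (e : G.edgeSet) : ℝ :=
  flowRate w (Quot.out e.1).1 (Quot.out e.1).2

/-- The arbitrary orientation chosen by `Quot.out` is harmless because the flow rate is symmetric.
-/
lemma flowField_mk (hG : G.Connected) {w : G.edgeSet → ℝ} (hw : ∀ e, 0 < w e) {x y : V}
    (h : G.Adj x y) : flowField w ⟨s(x, y), G.mem_edgeSet.mpr h⟩ = flowRate w x y := by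
  have : s((Quot.out s(x, y)).1, (Quot.out s(x, y)).2) = s(x, y) := Quot.out_eq s(x, y)
  unfold flowField
  rcases Sym2.eq_iff.mp this with ⟨h1, h2⟩ | ⟨h1, h2⟩
  · rw [h1, h2]
  · rw [h1, h2, flowRate_comm hG hw h]

lemma isTameField_flowField [Fintype G.edgeSet] (hG : G.Connected) :
    IsTameField (flowField (G := G)) where
  lipschitz a b ha := by
    set C : ℝ := 2 * Fintype.card V * ((Fintype.card V + 1) * |b| / a) + 8 * Fintype.card V
    have hC : 0 ≤ C := by positivity
    refine ⟨C.toNNReal, LipschitzOnWith.of_dist_le_mul fun w hw w' hw' => ?_⟩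
    rw [Real.coe_toNNReal C hC]
    refine (dist_pi_le_iff (by positivity)).mpr fun e => ?_
    have h1 := flowRate_le_add hG ha (abs_nonneg b) hw.1 (fun i => (hw.2 i).trans (le_abs_self b))
      hw'.1 dist_nonneg (fun i => dist_le_pi_dist w w' i) (adj_out e)
    have h2 := flowRate_le_add hG ha (abs_nonneg b) hw'.1
      (fun i => (hw'.2 i).trans (le_abs_self b)) hw.1 dist_nonneg
      (fun i => dist_le_pi_dist w' w i) (adj_out e)
    rw [dist_comm w' w] at h2
    rw [Real.dist_eq, abs_le]
    constructor
    · unfold flowField; linarith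
    · unfold flowField; linarith
  lower w hw e := by
    have := neg_weight_le_flowRate hG hw (adj_out e)
    rwa [weight_out] at this
  upper w hw e := flowRate_le_sum hG hw (adj_out e)

lemma isSolution_iff [Fintype G.edgeSet] (hG : G.Connected) {w₀ : G.edgeSet → ℝ} {I : Set ℝ}
    {w : ℝ → G.edgeSet → ℝ} :
    IsSolution w₀ I w ↔ w 0 = w₀ ∧ IsPositiveCurve flowField I w := by
  constructor
  · intro h
    refine ⟨h.initial, h.pos, fun t ht => hasDerivWithinAt_pi.mpr ?_⟩
    rintro ⟨e, he⟩
    induction e using Sym2.ind with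
    | _ x y =>
      have hxy : G.Adj x y := G.mem_edgeSet.mp he
      rw [flowField_mk hG (h.pos t ht) hxy, ← neg_curvature_mul_dist hG (h.pos t ht) hxy]
      exact h.deriv t ht x y hxy
  · rintro ⟨h0, h⟩
    refine ⟨h0, h.pos, fun t ht x y hxy => ?_⟩
    rw [neg_curvature_mul_dist hG (h.pos t ht) hxy, ← flowField_mk hG (h.pos t ht) hxy]
    exact hasDerivWithinAt_pi.mp (h.deriv t ht) _

end Flow

end RicciFlow

theorem theorem1 {V : Type*} [Fintype V] (G : SimpleGraph V) (hG : G.Connected) :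
    -- The limit that defines the curvature exists for every positive weight and every edge.
    (∀ w : G.edgeSet → ℝ, (∀ e, 0 < w e) → ∀ x y : V, G.Adj x y →
      Tendsto (RicciFlow.curvatureQuotient w x y) (𝓝[<] (1 : ℝ))
        (𝓝 (RicciFlow.curvature w x y))) ∧
    -- For every positive initial weight there is a solution for all times; it is the only one, also
    -- among the solutions that are only given on a bounded time interval.
    ∀ w₀ : G.edgeSet → ℝ, (∀ e, 0 < w₀ e) →
      ∃ w : ℝ → G.edgeSet → ℝ, RicciFlow.IsSolution w₀ (Set.Ici 0) w ∧
        (∀ v : ℝ → G.edgeSet → ℝ, RicciFlow.IsSolution w₀ (Set.Ici 0) v →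
          Set.EqOn v w (Set.Ici 0)) ∧
        (∀ T : ℝ, 0 < T → ∀ v : ℝ → G.edgeSet → ℝ, RicciFlow.IsSolution w₀ (Set.Ico 0 T) v →
          Set.EqOn v w (Set.Ico 0 T)) := by
  refine ⟨fun w hw x y h => ?_, fun w₀ hw₀ => ?_⟩
  · rw [RicciFlow.curvature_eq hG hw h]
    exact RicciFlow.tendsto_curvatureQuotient hG hw h
  · have := Fintype.ofFinite G.edgeSet
    have hF := RicciFlow.isTameField_flowField hG
    obtain ⟨w, hw0, hw⟩ := RicciFlow.exists_isPositiveCurve_Ici hF hw₀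
    simp only [RicciFlow.isSolution_iff hG]
    refine ⟨w, ⟨hw0, hw⟩, fun v hv t ht => ?_, fun T _ v hv => ?_⟩
    -- Uniqueness on the half-line follows from the bounded interval `[0, t + 1)` for each `t`.
    · exact (hv.2.mono Set.Ico_subset_Ici_self).eqOn hF (hw.mono Set.Ico_subset_Ici_self)
        (hv.1.trans hw0.symm) (⟨ht, lt_add_one t⟩ : t ∈ Set.Ico 0 (t + 1))
    · exact hv.2.eqOn hF (hw.mono Set.Ico_subset_Ici_self) (hv.1.trans hw0.symm)
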